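/- Let $c>0$ be an integer, $\mu,\nu\in\mathbb R$, $e(x)=e^{2\pi i x}$ and $A=C(\mathbb T^2)$, $\mathbb T^2=(\mathbb R/\mathbb Z)^2$. Let $X^c_{\mu,\nu}$ be the space of continuous functions $\xi:\mathbb R\times\mathbb R\to\mathbb C$ with $\xi(x+1,y)=e(-c(y-\nu))\xi(x,y)$ and $\xi(x,y+1)=\xi(x,y)$. It is a Hilbert $A$-$A$-bimodule with $(a\xi)(x,y)=a(x,y)\xi(x,y)$, $(\xi a)(x,y)=\xi(x,y)\,a(x-2\mu,y-2\nu)$, ${}_A\langle\xi,\eta\rangle(x,y)=\xi(x,y)\overline{\eta(x,y)}$ and $\langle\xi,\eta\rangle_A(x,y)=\overline{\xi(x+2\mu,y+2\nu)}\,\eta(x+2\mu,y+2\nu)$. A covariant representation of a Hilbert $A$-$A$-bimodule $X$ on a $C^*$-algebra $B$ is a pair consisting of a $*$-homomorphism $\pi:A\to B$ and a linear map $T:X\to B$ with $T(\xi)^*T(\zeta)=\pi(\langle\xi,\zeta\rangle_A)$, $T(\xi)\pi(a)=T(\xi a)$, $\pi(a)T(\xi)=T(a\xi)$ and $T(\xi)T(\zeta)^*=\pi({}_A\langle\xi,\zeta\rangle)$.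 The quantum Heisenberg manifold $D^c_{\mu,\nu}$ is the generalised crossed product of $A$ by $X^c_{\mu,\nu}$, i.e. the universal $C^*$-algebra generated by the covariant representations of $X^c_{\mu,\nu}$; $A$ and $X^c_{\mu,\nu}$ are identified with their canonical images in $D^c_{\mu,\nu}$ (functions of degree $0$ and $1$). A continuous function $G$ on $\mathbb R\times\mathbb R$ with $G(x+1,y)=e(c(y+\nu))G(x,y)$ and $G(x,y+1)=G(x,y)$ (a function of degree $-1$) is identified with the element $(G^*)^*$ of $D^c_{\mu,\nu}$, where $G^*\in X^c_{\mu,\nu}$ is $G^*(x,y)=\overline{G(x-2\mu,y-2\nu)}$. The Heisenberg group $H$, in coordinates $(r,s,t)\in\mathbb R^3$ with $(r,s,t)(r',s',t')=(r+r',s+s',t+t'+c\,s\,r')$, acts on $D^c_{\mu,\nu}$ by the $*$-automorphisms $\alpha_{(r,s,t)}$ determined by $\alpha_{(r,s,t)}(a)(x,y)=a(x-r,y-s)$ for $a\in A$ and $\alpha_{(r,s,t)}(\xi)(x,y)=e\big(-(t+cs(x-r-\mu))\big)\,\xi(x-r,y-s)$ for $\xi\in X^c_{\mu,\nu}$. Let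 $\alpha'$ be the corresponding action on $D^c_{\nu,\mu}$. Then, for $a\in A$ and $\xi\in X^c_{\mu,\nu}$, the formulas $$\pi(a)(x,y)=a(-y,-x),\qquad T(\xi)(x,y)=e^{2\pi i c(y+\mu)(x+\nu)}\,\xi(-y,-x),$$ where $\pi(a)$ is a function of degree $0$ and $T(\xi)$ a function of degree $-1$ for the parameters $(\nu,\mu)$, define a covariant representation $(\pi,T)$ of $X^c_{\mu,\nu}$ on $D^c_{\nu,\mu}$. The unique $*$-homomorphism $\Phi:D^c_{\mu,\nu}\to D^c_{\nu,\mu}$ with $\Phi(a)=\pi(a)$ and $\Phi(\xi)=T(\xi)$ for all $a\in A$, $\xi\in X^c_{\mu,\nu}$ exists and is an isomorphism of $C^*$-algebras, and for all $r,s,t\in\mathbb R$ and $F\in D^c_{\mu,\nu}$ $$\Phi(\alpha_{(r,s,t)}(F))=\alpha'_{(-s,-r,-t+csr)}(\Phi(F)).$$ -/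

import Mathlib

open scoped ENNReal ComplexConjugate
open Filter Topology

universe u v w

/-! ### Hilbert bimodules, covariant representations, generalised crossed products -/

/-- An `A`-`A`-Hilbert bimodule: a complex vector space `E` which is a right Hilbert `A`-module
(inner product `innerR`, conjugate linear in the first variable) and a left Hilbert `A`-module
(inner product `innerL`, conjugate linear in the second variable), the two inner products being
related by `ξ ⟨ζ, η⟩_R = ⟨ξ, ζ⟩_L η`. Positivity of `x` in the C⋆-algebra `A` is expressed as
`x = b⋆ b`, and completeness refers to the norms `‖⟨ξ, ξ⟩‖ ^ (1/2)`. -/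
class HilbertBimodule (A : Type u) [NonUnitalCStarAlgebra A]
    (E : Type v) [AddCommGroup E] [Module ℂ E] where
  lsmul : A →ₗ[ℂ] E →ₗ[ℂ] E
  rsmul : E →ₗ[ℂ] A →ₗ[ℂ] E
  innerR : E →ₗ⋆[ℂ] E →ₗ[ℂ] A
  innerL : E →ₗ[ℂ] E →ₗ⋆[ℂ] A
  mul_lsmul : ∀ a b ξ, lsmul (a * b) ξ = lsmul a (lsmul b ξ)
  rsmul_mul : ∀ ξ a b, rsmul ξ (a * b) = rsmul (rsmul ξ a) b
  lsmul_rsmul : ∀ a ξ b, lsmul a (rsmul ξ b) = rsmul (lsmul a ξ) b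
  innerR_rsmul : ∀ ξ η a, innerR ξ (rsmul η a) = innerR ξ η * a
  star_innerR : ∀ ξ η, star (innerR ξ η) = innerR η ξ
  innerR_self_nonneg : ∀ ξ, ∃ b, innerR ξ ξ = star b * b
  eq_zero_of_innerR_self : ∀ ξ, innerR ξ ξ = 0 → ξ = 0
  completeR : ∀ f : ℕ → E,
    (∀ ε > 0, ∃ N, ∀ m ≥ N, ∀ n ≥ N, ‖innerR (f m - f n) (f m - f n)‖ < ε) →
      ∃ ξ, Tendsto (fun n => ‖innerR (f n - ξ) (f n - ξ)‖) atTop (𝓝 0)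
  innerL_lsmul : ∀ a ξ η, innerL (lsmul a ξ) η = a * innerL ξ η
  star_innerL : ∀ ξ η, star (innerL ξ η) = innerL η ξ
  innerL_self_nonneg : ∀ ξ, ∃ b, innerL ξ ξ = star b * b
  eq_zero_of_innerL_self : ∀ ξ, innerL ξ ξ = 0 → ξ = 0
  completeL : ∀ f : ℕ → E,
    (∀ ε > 0, ∃ N, ∀ m ≥ N, ∀ n ≥ N, ‖innerL (f m - f n) (f m - f n)‖ < ε) →
      ∃ ξ, Tendsto (fun n => ‖innerL (f n - ξ) (f n - ξ)‖) atTop (𝓝 0)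
  rsmul_innerR : ∀ ξ ζ η, rsmul ξ (innerR ζ η) = lsmul (innerL ξ ζ) η

/-- A covariant representation `(π, τ)` of the Hilbert bimodule `E` on a C⋆-algebra `B`. -/
structure CovariantRep (A : Type u) [NonUnitalCStarAlgebra A]
    (E : Type v) [AddCommGroup E] [Module ℂ E] [HilbertBimodule A E]
    (B : Type w) [NonUnitalCStarAlgebra B] where
  π : A →⋆ₙₐ[ℂ] B
  τ : E →ₗ[ℂ] B
  star_τ_mul_τ : ∀ ξ ζ, star (τ ξ) * τ ζ = π (HilbertBimodule.innerR ξ ζ)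
  τ_mul_π : ∀ ξ a, τ ξ * π a = τ (HilbertBimodule.rsmul ξ a)
  π_mul_τ : ∀ a ξ, π a * τ ξ = τ (HilbertBimodule.lsmul a ξ)
  τ_mul_star_τ : ∀ ξ ζ, τ ξ * star (τ ζ) = π (HilbertBimodule.innerL ξ ζ)

section GenCrossedProduct

variable (A : Type u) [NonUnitalCStarAlgebra A]
  (E : Type v) [AddCommGroup E] [Module ℂ E] [HilbertBimodule A E]

/-- A C⋆-algebra together with a covariant representation on it. The C⋆-algebra generated by the
images of `A` and `E` in any covariant representation is in bijection with a type in the universe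
`max u v`, so that restricting the carriers to this universe loses nothing. -/
structure CovariantPair where
  carrier : Type (max u v)
  [cstar : NonUnitalCStarAlgebra carrier]
  rep : CovariantRep A E carrier

instance CovariantPair.instCStar (i : CovariantPair.{u, v} A E) :
    NonUnitalCStarAlgebra i.carrier := i.cstar

/-- The `ℓ^∞`-product of the targets of all covariant representations. -/
abbrev CovariantProduct : Type (max u v + 1) :=
  lp (fun i : CovariantPair.{u, v} A E => i.carrier) ∞

variable {A E}

theorem CovariantRep.norm_τ_sq_le {B : Type w} [NonUnitalCStarAlgebra B]
    (ρ : CovariantRep A E B) (ξ : E) :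
    ‖ρ.τ ξ‖ ≤ Real.sqrt ‖HilbertBimodule.innerR (A := A) ξ ξ‖ := by
  apply Real.le_sqrt_of_sq_le
  rw [sq, ← CStarRing.norm_star_mul_self, ρ.star_τ_mul_τ]
  exact NonUnitalStarAlgHom.norm_apply_le ρ.π _

/-- `a ↦ (π a)_(π, τ)`. -/
noncomputable def productA (a : A) : CovariantProduct A E :=
  ⟨fun i => i.rep.π a, memℓp_infty ⟨‖a‖, by
    rintro _ ⟨i, rfl⟩; exact NonUnitalStarAlgHom.norm_apply_le i.rep.π a⟩⟩

/-- `ξ ↦ (τ ξ)_(π, τ)`. -/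
noncomputable def productE (ξ : E) : CovariantProduct A E :=
  ⟨fun i => i.rep.τ ξ, memℓp_infty ⟨Real.sqrt ‖HilbertBimodule.innerR (A := A) ξ ξ‖, by
    rintro _ ⟨i, rfl⟩; exact i.rep.norm_τ_sq_le ξ⟩⟩

variable (A E)

/-- The elements of the product coming from `A` and from `E`. -/
def productGenerators : Set (CovariantProduct A E) :=
  Set.range (productA (E := E)) ∪ Set.range (productE (A := A))

/-- The generalised crossed product `A ⋊_E ℤ`, i.e. the universal C⋆-algebra generated by the
covariant representations of `E`: the C⋆-algebra generated by `A` and `E` in the product of all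
covariant representations. -/
noncomputable def genCrossedProduct : NonUnitalStarSubalgebra ℂ (CovariantProduct A E) :=
  (NonUnitalStarAlgebra.adjoin ℂ (productGenerators A E)).topologicalClosure

/-- `A ⋊_E ℤ` as a type. -/
abbrev GenCrossedProduct : Type (max u v + 1) := genCrossedProduct A E

instance genCrossedProduct_isClosed :
    IsClosed (genCrossedProduct A E : Set (CovariantProduct A E)) :=
  NonUnitalStarSubalgebra.isClosed_topologicalClosure _

noncomputable instance : NonUnitalCStarAlgebra (GenCrossedProduct A E) :=
  NonUnitalStarSubalgebra.nonUnitalCStarAlgebra (genCrossedProduct A E)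

variable {A E}

theorem mem_genCrossedProduct {x : CovariantProduct A E} (hx : x ∈ productGenerators A E) :
    x ∈ genCrossedProduct A E :=
  NonUnitalStarSubalgebra.le_topologicalClosure _ (NonUnitalStarAlgebra.subset_adjoin ℂ _ hx)

/-- The universal covariant representation. -/
noncomputable def univRep : CovariantRep A E (GenCrossedProduct A E) where
  π :=
    { toFun := fun a => ⟨productA a, mem_genCrossedProduct (Or.inl ⟨a, rfl⟩)⟩
      map_smul' := fun k a => Subtype.ext (Subtype.ext (funext fun i => map_smul i.rep.π k a))
      map_zero' := Subtype.ext (Subtype.ext (funext fun i => map_zero i.rep.π))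
      map_add' := fun a b => Subtype.ext (Subtype.ext (funext fun i => map_add i.rep.π a b))
      map_mul' := fun a b => Subtype.ext (Subtype.ext (funext fun i => map_mul i.rep.π a b))
      map_star' := fun a => Subtype.ext (Subtype.ext (funext fun i => map_star i.rep.π a)) }
  τ :=
    { toFun := fun ξ => ⟨productE ξ, mem_genCrossedProduct (Or.inr ⟨ξ, rfl⟩)⟩
      map_add' := fun a b => Subtype.ext (Subtype.ext (funext fun i => map_add i.rep.τ a b))
      map_smul' := fun k a => Subtype.ext (Subtype.ext (funext fun i => map_smul i.rep.τ k a)) }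
  star_τ_mul_τ := fun ξ ζ =>
    Subtype.ext (Subtype.ext (funext fun i => i.rep.star_τ_mul_τ ξ ζ))
  τ_mul_π := fun ξ a => Subtype.ext (Subtype.ext (funext fun i => i.rep.τ_mul_π ξ a))
  π_mul_τ := fun a ξ => Subtype.ext (Subtype.ext (funext fun i => i.rep.π_mul_τ a ξ))
  τ_mul_star_τ := fun ξ ζ =>
    Subtype.ext (Subtype.ext (funext fun i => i.rep.τ_mul_star_τ ξ ζ))

/-- A `*`-homomorphism on the generalised crossed product is determined by its values on
`A` and `E`. -/
theorem GenCrossedProduct.hom_ext {B : Type w} [NonUnitalCStarAlgebra B]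
    {f g : GenCrossedProduct A E →⋆ₙₐ[ℂ] B}
    (hA : ∀ a, f ((univRep (A := A) (E := E)).π a) = g (univRep.π a))
    (hE : ∀ ξ, f ((univRep (A := A) (E := E)).τ ξ) = g (univRep.τ ξ)) : f = g := by
  have hf : Continuous f :=
    AddMonoidHomClass.continuous_of_bound f 1 fun x => by
      simpa using NonUnitalStarAlgHom.norm_apply_le f x
  have hg : Continuous g :=
    AddMonoidHomClass.continuous_of_bound g 1 fun x => by
      simpa using NonUnitalStarAlgHom.norm_apply_le g x
  have key : ∀ x : CovariantProduct A E,
      ∀ hx : x ∈ NonUnitalStarAlgebra.adjoin ℂ (productGenerators A E),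
      f ⟨x, NonUnitalStarSubalgebra.le_topologicalClosure _ hx⟩ =
        g ⟨x, NonUnitalStarSubalgebra.le_topologicalClosure _ hx⟩ := by
    intro x hx
    induction hx using NonUnitalStarAlgebra.adjoin_induction with
    | mem x hx =>
      rcases hx with ⟨a, rfl⟩ | ⟨ξ, rfl⟩
      · exact hA a
      · exact hE ξ
    | add x y hx hy h1 h2 =>
      have := congrArg₂ (· + ·) h1 h2
      simp only [← map_add] at this
      exact this
    | zero => exact (map_zero f).trans (map_zero g).symm
    | mul x y hx hy h1 h2 =>
      have := congrArg₂ (· * ·) h1 h2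
      simp only [← map_mul] at this
      exact this
    | smul r x hx h1 =>
      have := congrArg (r • ·) h1
      simp only [← map_smul] at this
      exact this
    | star x hx h1 =>
      have := congrArg star h1
      simp only [← map_star] at this
      exact this
  ext ⟨x, hx⟩
  have hx' : x ∈ closure
      (NonUnitalStarAlgebra.adjoin ℂ (productGenerators A E) : Set (CovariantProduct A E)) := hx
  obtain ⟨y, hy, hlim⟩ := mem_closure_iff_seq_limit.1 hx'
  have hlim' : Tendsto (fun n => (⟨y n, NonUnitalStarSubalgebra.le_topologicalClosure _ (hy n)⟩ :
      GenCrossedProduct A E)) atTop (𝓝 ⟨x, hx⟩) := tendsto_subtype_rng.2 hlim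
  refine tendsto_nhds_unique ((hf.tendsto _).comp hlim') ?_
  refine ((hg.tendsto _).comp hlim').congr fun n => ?_
  exact (key _ (hy n)).symm

/-- The universal property of the generalised crossed product. -/
theorem GenCrossedProduct.existsUnique_lift (B : Type (max u v)) [NonUnitalCStarAlgebra B]
    (ρ : CovariantRep A E B) :
    ∃! f : GenCrossedProduct A E →⋆ₙₐ[ℂ] B,
      (∀ a, f (univRep.π a) = ρ.π a) ∧ ∀ ξ, f (univRep.τ ξ) = ρ.τ ξ := by
  refine ⟨
    { toFun := fun x => x.1 ⟨B, ρ⟩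
      map_smul' := fun _ _ => rfl
      map_zero' := rfl
      map_add' := fun _ _ => rfl
      map_mul' := fun _ _ => rfl
      map_star' := fun _ => rfl }, ⟨fun _ => rfl, fun _ => rfl⟩, ?_⟩
  rintro g ⟨h1, h2⟩
  exact GenCrossedProduct.hom_ext (fun a => h1 a) (fun ξ => h2 ξ)

/-- An endomorphism of the Hilbert bimodule `E` over an endomorphism of `A`. -/
structure HilbertBimoduleEnd (A : Type u) [NonUnitalCStarAlgebra A]
    (E : Type v) [AddCommGroup E] [Module ℂ E] [HilbertBimodule A E] where
  onA : A →⋆ₙₐ[ℂ] A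
  onE : E →ₗ[ℂ] E
  map_lsmul : ∀ a ξ, onE (HilbertBimodule.lsmul a ξ) = HilbertBimodule.lsmul (onA a) (onE ξ)
  map_rsmul : ∀ ξ a, onE (HilbertBimodule.rsmul ξ a) = HilbertBimodule.rsmul (onE ξ) (onA a)
  map_innerR : ∀ ξ ζ,
    onA (HilbertBimodule.innerR ξ ζ) = HilbertBimodule.innerR (onE ξ) (onE ζ)
  map_innerL : ∀ ξ ζ,
    onA (HilbertBimodule.innerL ξ ζ) = HilbertBimodule.innerL (onE ξ) (onE ζ)

/-- The pull-back of a covariant representation by a bimodule endomorphism. -/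
def CovariantRep.pull {B : Type w} [NonUnitalCStarAlgebra B] (ρ : CovariantRep A E B)
    (φ : HilbertBimoduleEnd A E) : CovariantRep A E B where
  π := ρ.π.comp φ.onA
  τ := ρ.τ.comp φ.onE
  star_τ_mul_τ := fun ξ ζ => by simp [ρ.star_τ_mul_τ, φ.map_innerR]
  τ_mul_π := fun ξ a => by simp [ρ.τ_mul_π, φ.map_rsmul]
  π_mul_τ := fun a ξ => by simp [ρ.π_mul_τ, φ.map_lsmul]
  τ_mul_star_τ := fun ξ ζ => by simp [ρ.τ_mul_star_τ, φ.map_innerL]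

/-- The endomorphism of the product of all covariant representations whose
`(π, τ)`-component is the component at the pull-back of `(π, τ)`. -/
noncomputable def productMap (φ : HilbertBimoduleEnd A E) :
    CovariantProduct A E →⋆ₙₐ[ℂ] CovariantProduct A E where
  toFun := fun x => ⟨fun i => x ⟨i.carrier, i.rep.pull φ⟩, memℓp_infty ⟨‖x‖, by
    rintro _ ⟨i, rfl⟩
    exact lp.norm_apply_le_norm ENNReal.top_ne_zero x ⟨i.carrier, i.rep.pull φ⟩⟩⟩
  map_smul' := fun _ _ => rfl
  map_zero' := rfl
  map_add' := fun _ _ => rfl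
  map_mul' := fun _ _ => rfl
  map_star' := fun _ => rfl

theorem productMap_mem (φ : HilbertBimoduleEnd A E) (x : CovariantProduct A E)
    (hx : x ∈ genCrossedProduct A E) : productMap φ x ∈ genCrossedProduct A E := by
  have hc : Continuous (productMap φ) :=
    AddMonoidHomClass.continuous_of_bound (productMap φ) 1 fun x => by
      simpa using NonUnitalStarAlgHom.norm_apply_le (productMap φ) x
  have h : genCrossedProduct A E ≤ (genCrossedProduct A E).comap (productMap φ) := by
    refine NonUnitalStarSubalgebra.topologicalClosure_minimal _ ?_
      ((genCrossedProduct_isClosed A E).preimage hc)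
    refine NonUnitalStarAlgebra.adjoin_le ?_
    rintro _ (⟨a, rfl⟩ | ⟨ξ, rfl⟩)
    · exact mem_genCrossedProduct (Or.inl ⟨φ.onA a, rfl⟩)
    · exact mem_genCrossedProduct (Or.inr ⟨φ.onE ξ, rfl⟩)
  exact h hx

/-- The endomorphism of `A ⋊_E ℤ` induced by an endomorphism of `E`. -/
noncomputable def GenCrossedProduct.map (φ : HilbertBimoduleEnd A E) :
    GenCrossedProduct A E →⋆ₙₐ[ℂ] GenCrossedProduct A E where
  toFun := fun x => ⟨productMap φ x.1, productMap_mem φ x.1 x.2⟩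
  map_smul' := fun _ _ => rfl
  map_zero' := rfl
  map_add' := fun _ _ => rfl
  map_mul' := fun _ _ => rfl
  map_star' := fun _ => rfl

theorem GenCrossedProduct.map_π (φ : HilbertBimoduleEnd A E) (a : A) :
    GenCrossedProduct.map φ (univRep.π a) = univRep.π (φ.onA a) := rfl

theorem GenCrossedProduct.map_τ (φ : HilbertBimoduleEnd A E) (ξ : E) :
    GenCrossedProduct.map φ (univRep.τ ξ) = univRep.τ (φ.onE ξ) := rfl

end GenCrossedProduct

/-! ### The Hilbert bimodule over `C(𝕋²)` -/

namespace QHM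

/-- The torus `𝕋² = (ℝ/ℤ)²`. -/
abbrev Torus : Type := UnitAddCircle × UnitAddCircle

/-- `e x = exp (2πix)`. -/
noncomputable def e (x : ℝ) : ℂ := Complex.exp (2 * Real.pi * Complex.I * x)

theorem e_add (x y : ℝ) : e (x + y) = e x * e y := by
  simp only [e, ← Complex.exp_add]
  congr 1
  push_cast
  ring

theorem e_zero : e 0 = 1 := by simp [e]

theorem star_e (x : ℝ) : star (e x) = e (-x) := by
  rw [Complex.star_def]
  simp only [e, ← Complex.exp_conj]
  congr 1
  simp [Complex.conj_ofNat]

theorem e_mul_star (x : ℝ) : e x * star (e x) = 1 := by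
  rw [star_e, ← e_add, add_neg_cancel, e_zero]

theorem norm_e (x : ℝ) : ‖e x‖ = 1 := by
  have h : (2 * Real.pi * Complex.I * x : ℂ) = ((2 * Real.pi * x : ℝ) : ℂ) * Complex.I := by
    push_cast
    ring
  rw [e, h, Complex.norm_exp_ofReal_mul_I]

theorem continuous_e : Continuous e := by
  unfold e
  fun_prop

/-- The quotient map `ℝ² → 𝕋²`. -/
def torusProj : C(ℝ × ℝ, Torus) :=
  ⟨fun z => ((z.1 : UnitAddCircle), (z.2 : UnitAddCircle)), by
    have h : Continuous (fun x : ℝ => (x : UnitAddCircle)) := AddCircle.continuous_mk' 1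
    exact (h.comp continuous_fst).prodMk (h.comp continuous_snd)⟩

theorem torusProj_surjective : Function.Surjective torusProj := by
  rintro ⟨p, q⟩
  obtain ⟨x, rfl⟩ := QuotientAddGroup.mk_surjective p
  obtain ⟨y, rfl⟩ := QuotientAddGroup.mk_surjective q
  exact ⟨(x, y), rfl⟩

theorem torusProj_isQuotientMap : IsQuotientMap torusProj := by
  have h : IsOpenQuotientMap (fun x : ℝ => (x : UnitAddCircle)) :=
    QuotientAddGroup.isOpenQuotientMap_mk
  exact (h.prodMap h).isQuotientMap

theorem torus_ext {f g : C(Torus, ℂ)} (h : ∀ x y, f (torusProj (x, y)) = g (torusProj (x, y))) :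
    f = g := by
  ext p
  obtain ⟨⟨x, y⟩, rfl⟩ := torusProj_surjective p
  exact h x y

/-- Functions of period one in both variables. -/
def DoublyPeriodic (f : ℝ × ℝ → ℂ) : Prop :=
  ∀ x y, f (x + 1, y) = f (x, y) ∧ f (x, y + 1) = f (x, y)

theorem DoublyPeriodic.factorsThrough {f : ℝ × ℝ → ℂ} (hf : DoublyPeriodic f) :
    Function.FactorsThrough f torusProj := by
  have h1 : ∀ y, Function.Periodic (fun x => f (x, y)) 1 := fun y x => (hf x y).1
  have h2 : ∀ x, Function.Periodic (fun y => f (x, y)) 1 := fun x y => (hf x y).2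
  rintro ⟨x, y⟩ ⟨x', y'⟩ h
  obtain ⟨hx, hy⟩ := Prod.ext_iff.1 h
  calc f (x, y) = (h1 y).lift (x : UnitAddCircle) := ((h1 y).lift_coe x).symm
    _ = (h1 y).lift (x' : UnitAddCircle) := congrArg (h1 y).lift hx
    _ = f (x', y) := (h1 y).lift_coe x'
    _ = (h2 x').lift (y : UnitAddCircle) := ((h2 x').lift_coe y).symm
    _ = (h2 x').lift (y' : UnitAddCircle) := congrArg (h2 x').lift hy
    _ = f (x', y') := (h2 x').lift_coe y'

/-- The function on the torus defined by a doubly periodic continuous function on the plane. -/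
noncomputable def descend (f : C(ℝ × ℝ, ℂ)) (hf : DoublyPeriodic f) : C(Torus, ℂ) :=
  torusProj_isQuotientMap.lift f hf.factorsThrough

theorem descend_proj (f : C(ℝ × ℝ, ℂ)) (hf : DoublyPeriodic f) (z : ℝ × ℝ) :
    descend f hf (torusProj z) = f z :=
  congrArg (fun g : C(ℝ × ℝ, ℂ) => g z) (torusProj_isQuotientMap.lift_comp f hf.factorsThrough)

/-- The translation `(x, y) ↦ (x + a, y + b)` of the plane. -/
def planeShift (a b : ℝ) : C(ℝ × ℝ, ℝ × ℝ) := ⟨fun z => (z.1 + a, z.2 + b), by fun_prop⟩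

/-- The translation `(x, y) ↦ (x + a, y + b)` of the torus. -/
def torusShift (a b : ℝ) : C(Torus, Torus) := ⟨fun p => (p.1 + a, p.2 + b), by fun_prop⟩

theorem torusShift_proj (a b x y : ℝ) :
    torusShift a b (torusProj (x, y)) = torusProj (x + a, y + b) := rfl

/-- The space `X^c_{μ,ν}` of continuous functions `ξ` on `ℝ × ℝ/ℤ` with
`ξ (x + 1, y) = e (-c (y - ν)) ξ (x, y)`; functions on `ℝ × ℝ/ℤ` are functions on `ℝ²` of period one
in the second variable. (The parameter `μ` enters only into the bimodule structure.) -/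
def modQHM (c : ℤ) (_μ ν : ℝ) : Submodule ℂ C(ℝ × ℝ, ℂ) where
  carrier := {ξ | ∀ x y : ℝ,
    ξ (x + 1, y) = e (-(c * (y - ν))) * ξ (x, y) ∧ ξ (x, y + 1) = ξ (x, y)}
  add_mem' := fun {ξ η} hξ hη x y => by
    simp only [ContinuousMap.add_apply, (hξ x y).1, (hξ x y).2, (hη x y).1, (hη x y).2]
    exact ⟨by ring, trivial⟩
  zero_mem' := fun x y => by simp
  smul_mem' := fun k ξ hξ x y => by
    simp only [ContinuousMap.smul_apply, (hξ x y).1, (hξ x y).2, smul_eq_mul]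
    exact ⟨by ring, trivial⟩

variable {c : ℤ} {μ ν : ℝ}

theorem doublyPeriodic_mul_star (ξ η : modQHM c μ ν) :
    DoublyPeriodic (ξ.1 * star η.1 : C(ℝ × ℝ, ℂ)) := by
  intro x y
  simp only [ContinuousMap.mul_apply, ContinuousMap.star_apply, (ξ.2 x y).1, (ξ.2 x y).2,
    (η.2 x y).1, (η.2 x y).2, star_mul]
  refine ⟨?_, trivial⟩
  linear_combination (ξ.1 (x, y) * star (η.1 (x, y))) * e_mul_star (-(c * (y - ν)))

/-- `a ξ`, the pointwise product. -/
noncomputable def lsmulFun (a : C(Torus, ℂ)) (ξ : modQHM c μ ν) : modQHM c μ ν :=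
  ⟨a.comp torusProj * ξ.1, fun x y => by
    have h1 : torusProj (x + 1, y) = torusProj (x, y) := by simp [torusProj]
    have h2 : torusProj (x, y + 1) = torusProj (x, y) := by simp [torusProj]
    simp only [ContinuousMap.mul_apply, ContinuousMap.comp_apply, h1, h2, (ξ.2 x y).1,
      (ξ.2 x y).2]
    exact ⟨by ring, trivial⟩⟩

/-- The automorphism `σ(a)(x, y) = a (x - 2μ, y - 2ν)` of `C(𝕋²)`. -/
noncomputable def sigma (μ ν : ℝ) (a : C(Torus, ℂ)) : C(Torus, ℂ) := a.comp (torusShift (-(2 * μ)) (-(2 * ν)))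

/-- `⟨ξ, η⟩_L (x, y) = ξ (x, y) conj (η (x, y))`. -/
noncomputable def innerLFun (ξ η : modQHM c μ ν) : C(Torus, ℂ) :=
  descend (ξ.1 * star η.1) (doublyPeriodic_mul_star ξ η)

/-- `⟨ξ, η⟩_R (x, y) = conj (ξ (x + 2μ, y + 2ν)) η (x + 2μ, y + 2ν)`. -/
noncomputable def innerRFun (ξ η : modQHM c μ ν) : C(Torus, ℂ) :=
  (innerLFun η ξ).comp (torusShift (2 * μ) (2 * ν))

theorem lsmulFun_apply (a : C(Torus, ℂ)) (ξ : modQHM c μ ν) (x y : ℝ) :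
    (lsmulFun a ξ).1 (x, y) = a (torusProj (x, y)) * ξ.1 (x, y) := rfl

theorem sigma_proj (μ ν : ℝ) (a : C(Torus, ℂ)) (x y : ℝ) :
    sigma μ ν a (torusProj (x, y)) = a (torusProj (x - 2 * μ, y - 2 * ν)) := rfl

theorem innerLFun_proj (ξ η : modQHM c μ ν) (x y : ℝ) :
    innerLFun ξ η (torusProj (x, y)) = ξ.1 (x, y) * star (η.1 (x, y)) :=
  descend_proj _ _ _

theorem innerRFun_proj (ξ η : modQHM c μ ν) (x y : ℝ) :
    innerRFun ξ η (torusProj (x, y)) =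
      star (ξ.1 (x + 2 * μ, y + 2 * ν)) * η.1 (x + 2 * μ, y + 2 * ν) := by
  rw [mul_comm]
  exact innerLFun_proj η ξ _ _

theorem mod_ext {ξ η : modQHM c μ ν} (h : ∀ x y, ξ.1 (x, y) = η.1 (x, y)) : ξ = η :=
  Subtype.ext (ContinuousMap.ext fun z => h z.1 z.2)

theorem innerLFun_self_nonneg (ξ : modQHM c μ ν) :
    ∃ b : C(Torus, ℂ), innerLFun ξ ξ = star b * b := by
  have h : DoublyPeriodic (⟨fun z => (‖ξ.1 z‖ : ℂ), by fun_prop⟩ : C(ℝ × ℝ, ℂ)) := by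
    intro x y
    simp [(ξ.2 x y).1, (ξ.2 x y).2, norm_e]
  refine ⟨descend _ h, torus_ext fun x y => ?_⟩
  rw [innerLFun_proj, ContinuousMap.mul_apply, ContinuousMap.star_apply, descend_proj]
  simp only [Complex.star_def, Complex.mul_conj, ContinuousMap.coe_mk, Complex.conj_ofReal]
  rw [Complex.normSq_eq_norm_sq, sq]
  push_cast
  rfl

theorem innerRFun_self_nonneg (ξ : modQHM c μ ν) :
    ∃ b : C(Torus, ℂ), innerRFun ξ ξ = star b * b := by
  obtain ⟨b, hb⟩ := innerLFun_self_nonneg ξ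
  exact ⟨b.comp (torusShift (2 * μ) (2 * ν)), by rw [innerRFun, hb]; rfl⟩

theorem eq_zero_of_innerLFun_self (ξ : modQHM c μ ν) (h : innerLFun ξ ξ = 0) : ξ = 0 := by
  refine mod_ext fun x y => ?_
  have := innerLFun_proj ξ ξ x y
  rw [h, ContinuousMap.zero_apply, zero_eq_mul, star_eq_zero, or_self] at this
  simpa using this

theorem norm_innerRFun (ξ η : modQHM c μ ν) : ‖innerRFun ξ η‖ = ‖innerLFun η ξ‖ := by
  apply le_antisymm
  · refine (ContinuousMap.norm_le _ (norm_nonneg _)).2 fun p => ?_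
    exact ContinuousMap.norm_coe_le_norm (innerLFun η ξ) _
  · refine (ContinuousMap.norm_le _ (norm_nonneg _)).2 fun p => ?_
    have h : torusShift (2 * μ) (2 * ν) (torusShift (-(2 * μ)) (-(2 * ν)) p) = p := by
      simp [torusShift]
    have := ContinuousMap.norm_coe_le_norm (innerRFun ξ η) (torusShift (-(2 * μ)) (-(2 * ν)) p)
    rwa [innerRFun, ContinuousMap.comp_apply, h] at this

theorem innerRFun_self_eq_zero (ξ : modQHM c μ ν) (h : innerRFun ξ ξ = 0) : ξ = 0 := by
  refine eq_zero_of_innerLFun_self ξ (norm_eq_zero.1 ?_)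
  rw [← norm_innerRFun, h, norm_zero]

theorem completeLFun (f : ℕ → modQHM c μ ν)
    (hf : ∀ ε > 0, ∃ N, ∀ m ≥ N, ∀ n ≥ N, ‖innerLFun (f m - f n) (f m - f n)‖ < ε) :
    ∃ ξ, Tendsto (fun n => ‖innerLFun (f n - ξ) (f n - ξ)‖) atTop (𝓝 0) := by
  have key : ∀ ε > 0, ∃ N, ∀ m ≥ N, ∀ n ≥ N, ∀ z, ‖(f m).1 z - (f n).1 z‖ < ε := by
    intro ε hε
    obtain ⟨N, hN⟩ := hf (ε ^ 2) (by positivity)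
    refine ⟨N, fun m hm n hn z => ?_⟩
    have h1 := ContinuousMap.norm_coe_le_norm (innerLFun (f m - f n) (f m - f n))
      (torusProj (z.1, z.2))
    rw [innerLFun_proj, norm_mul, norm_star, ← sq] at h1
    exact lt_of_pow_lt_pow_left₀ 2 hε.le (h1.trans_lt (hN m hm n hn))
  have hpt : ∀ z, ∃ l, Tendsto (fun n => (f n).1 z) atTop (𝓝 l) := fun z =>
    cauchySeq_tendsto_of_complete (Metric.cauchySeq_iff.2 fun ε hε => by
      obtain ⟨N, hN⟩ := key ε hε
      exact ⟨N, fun m hm n hn => by rw [dist_eq_norm]; exact hN m hm n hn z⟩)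
  choose g hg using hpt
  have hunif : ∀ ε > 0, ∃ N, ∀ n ≥ N, ∀ z, ‖(f n).1 z - g z‖ ≤ ε := by
    intro ε hε
    obtain ⟨N, hN⟩ := key ε hε
    refine ⟨N, fun n hn z => ?_⟩
    refine le_of_tendsto ((tendsto_const_nhds.sub (hg z)).norm) ?_
    filter_upwards [eventually_ge_atTop N] with m hm using (hN n hn m hm z).le
  have hcont : Continuous g := by
    refine TendstoUniformly.continuous (F := fun n z => (f n).1 z) (p := atTop) ?_
      (Frequently.of_forall fun n => (f n).1.continuous)
    rw [Metric.tendstoUniformly_iff]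
    intro ε hε
    obtain ⟨N, hN⟩ := hunif (ε / 2) (half_pos hε)
    filter_upwards [eventually_ge_atTop N] with n hn z
    rw [dist_comm, dist_eq_norm]
    exact (hN n hn z).trans_lt (half_lt_self hε)
  have hmem : (⟨g, hcont⟩ : C(ℝ × ℝ, ℂ)) ∈ modQHM c μ ν := by
    intro x y
    refine ⟨tendsto_nhds_unique (hg _) ?_, tendsto_nhds_unique (hg _) ?_⟩
    · refine ((hg (x, y)).const_mul _).congr fun n => ?_
      exact ((f n).2 x y).1.symm
    · refine (hg (x, y)).congr fun n => ?_
      exact ((f n).2 x y).2.symm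
  refine ⟨⟨_, hmem⟩, ?_⟩
  rw [Metric.tendsto_atTop]
  intro ε hε
  obtain ⟨N, hN⟩ := hunif (Real.sqrt (ε / 2)) (by positivity)
  refine ⟨N, fun n hn => ?_⟩
  rw [dist_zero_right, norm_norm]
  refine lt_of_le_of_lt ((ContinuousMap.norm_le _ (half_pos hε).le).2 fun p => ?_)
    (half_lt_self hε)
  obtain ⟨⟨x, y⟩, rfl⟩ := torusProj_surjective p
  rw [innerLFun_proj, norm_mul, norm_star, ← sq]
  calc _ ≤ Real.sqrt (ε / 2) ^ 2 := pow_le_pow_left₀ (norm_nonneg _) (hN n hn (x, y)) 2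
    _ = ε / 2 := Real.sq_sqrt (half_pos hε).le

/-- The Hilbert bimodule structure of `X^c_{μ,ν}` over `C(𝕋²)`. -/
noncomputable instance : HilbertBimodule C(Torus, ℂ) (modQHM c μ ν) where
  lsmul := LinearMap.mk₂ ℂ lsmulFun
    (fun a b ξ => mod_ext fun x y => by simp [lsmulFun_apply, add_mul])
    (fun k a ξ => mod_ext fun x y => by simp [lsmulFun_apply, mul_assoc])
    (fun a ξ η => mod_ext fun x y => by simp [lsmulFun_apply, mul_add])
    (fun k a ξ => mod_ext fun x y => by simp [lsmulFun_apply, mul_left_comm])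
  rsmul := LinearMap.mk₂ ℂ (fun ξ a => lsmulFun (sigma μ ν a) ξ)
    (fun ξ η a => mod_ext fun x y => by simp [lsmulFun_apply, mul_add])
    (fun k ξ a => mod_ext fun x y => by simp [lsmulFun_apply, mul_left_comm])
    (fun ξ a b => mod_ext fun x y => by simp [lsmulFun_apply, sigma_proj, add_mul])
    (fun k ξ a => mod_ext fun x y => by simp [lsmulFun_apply, sigma_proj, mul_assoc])
  innerR := LinearMap.mk₂'ₛₗ (starRingEnd ℂ) (RingHom.id ℂ) innerRFun
    (fun ξ η ζ => torus_ext fun x y => by simp [innerRFun_proj, add_mul])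
    (fun k ξ η => torus_ext fun x y => by simp [innerRFun_proj, mul_assoc])
    (fun ξ η ζ => torus_ext fun x y => by simp [innerRFun_proj, mul_add])
    (fun k ξ η => torus_ext fun x y => by simp [innerRFun_proj, mul_left_comm])
  innerL := LinearMap.mk₂'ₛₗ (RingHom.id ℂ) (starRingEnd ℂ) innerLFun
    (fun ξ η ζ => torus_ext fun x y => by simp [innerLFun_proj, add_mul])
    (fun k ξ η => torus_ext fun x y => by simp [innerLFun_proj, mul_assoc])
    (fun ξ η ζ => torus_ext fun x y => by simp [innerLFun_proj, mul_add])
    (fun k ξ η => torus_ext fun x y => by simp [innerLFun_proj, mul_left_comm])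
  mul_lsmul := fun a b ξ => mod_ext fun x y => by simp [lsmulFun_apply, mul_assoc]
  rsmul_mul := fun ξ a b => mod_ext fun x y => by
    simp [lsmulFun_apply, sigma_proj, mul_assoc, mul_left_comm]
  lsmul_rsmul := fun a ξ b => mod_ext fun x y => by
    simp [lsmulFun_apply, mul_left_comm]
  innerR_rsmul := fun ξ η a => torus_ext fun x y => by
    simp [innerRFun_proj, lsmulFun_apply, sigma_proj]
    ring
  star_innerR := fun ξ η => torus_ext fun x y => by simp [innerRFun_proj, mul_comm]
  innerR_self_nonneg := innerRFun_self_nonneg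
  eq_zero_of_innerR_self := innerRFun_self_eq_zero
  completeR := fun f hf => by
    simp only [LinearMap.mk₂'ₛₗ_apply, norm_innerRFun] at hf ⊢
    exact completeLFun f hf
  innerL_lsmul := fun a ξ η => torus_ext fun x y => by
    simp [innerLFun_proj, lsmulFun_apply, mul_assoc]
  star_innerL := fun ξ η => torus_ext fun x y => by simp [innerLFun_proj, mul_comm]
  innerL_self_nonneg := innerLFun_self_nonneg
  eq_zero_of_innerL_self := eq_zero_of_innerLFun_self
  completeL := completeLFun
  rsmul_innerR := fun ξ ζ η => mod_ext fun x y => by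
    simp [innerRFun_proj, innerLFun_proj, lsmulFun_apply, sigma_proj]
    ring

/-- The quantum Heisenberg manifold `D^c_{μ,ν}`, the generalised crossed product of `C(𝕋²)` by
`X^c_{μ,ν}`. -/
abbrev Alg (c : ℤ) (μ ν : ℝ) : Type 1 := GenCrossedProduct C(Torus, ℂ) (modQHM c μ ν)

/-- The canonical map `C(𝕋²) → D^c_{μ,ν}` (functions of degree `0`). -/
noncomputable def ofTorus (c : ℤ) (μ ν : ℝ) (a : C(Torus, ℂ)) : Alg c μ ν :=
  (univRep (A := C(Torus, ℂ)) (E := modQHM c μ ν)).π a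

/-- The canonical map `X^c_{μ,ν} → D^c_{μ,ν}` (functions of degree `1`). -/
noncomputable def ofMod (ξ : modQHM c μ ν) : Alg c μ ν :=
  (univRep (A := C(Torus, ℂ)) (E := modQHM c μ ν)).τ ξ

/-! ### The action of the Heisenberg group -/

/-- The Heisenberg group in the coordinates `(r, s, t)` in which its multiplication is
`(r, s, t) (r', s', t') = (r + r', s + s', t + t' + c s r')`. For `c ≠ 0` the element `(r, s, t)`
is the matrix `Heis.toMatrix`. -/
@[ext]
structure Heis (c : ℤ) where
  r : ℝ
  s : ℝ
  t : ℝ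

instance : Mul (Heis c) := ⟨fun g h => ⟨g.r + h.r, g.s + h.s, g.t + h.t + c * g.s * h.r⟩⟩

instance : One (Heis c) := ⟨⟨0, 0, 0⟩⟩

instance : Inv (Heis c) := ⟨fun g => ⟨-g.r, -g.s, -g.t + c * g.s * g.r⟩⟩

theorem Heis.mul_def (g h : Heis c) :
    g * h = ⟨g.r + h.r, g.s + h.s, g.t + h.t + c * g.s * h.r⟩ := rfl

theorem Heis.one_def : (1 : Heis c) = ⟨0, 0, 0⟩ := rfl

theorem Heis.inv_def (g : Heis c) : g⁻¹ = ⟨-g.r, -g.s, -g.t + c * g.s * g.r⟩ := rfl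

instance : Group (Heis c) where
  mul_assoc g h k := by ext <;> simp only [Heis.mul_def] <;> ring
  one_mul g := by ext <;> simp [Heis.mul_def, Heis.one_def]
  mul_one g := by ext <;> simp [Heis.mul_def, Heis.one_def]
  inv_mul_cancel g := by ext <;> simp [Heis.mul_def, Heis.one_def, Heis.inv_def]

/-- The unipotent matrix with the coordinates `(r, s, t)`. -/
noncomputable def Heis.toMatrix (g : Heis c) : Matrix (Fin 3) (Fin 3) ℝ :=
  !![1, g.s, g.t / c; 0, 1, g.r; 0, 0, 1]

theorem Heis.toMatrix_mul (hc : c ≠ 0) (g h : Heis c) :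
    (g * h).toMatrix = g.toMatrix * h.toMatrix := by
  have hc' : (c : ℝ) ≠ 0 := by exact_mod_cast hc
  ext i j
  fin_cases i <;> fin_cases j <;>
    simp [toMatrix, mul_def, Matrix.mul_apply, Fin.sum_univ_three] <;>
    (try field_simp) <;> ring_nf

/-- The action on functions of degree `0`: `α_{(r,s,t)}(a)(x, y) = a (x - r, y - s)`. -/
noncomputable def heisOnTorus (g : Heis c) : C(Torus, ℂ) →⋆ₙₐ[ℂ] C(Torus, ℂ) where
  toFun := fun a => a.comp (torusShift (-g.r) (-g.s))
  map_smul' := fun _ _ => rfl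
  map_zero' := rfl
  map_add' := fun _ _ => rfl
  map_mul' := fun _ _ => rfl
  map_star' := fun _ => rfl

theorem heisOnTorus_proj (g : Heis c) (a : C(Torus, ℂ)) (x y : ℝ) :
    heisOnTorus g a (torusProj (x, y)) = a (torusProj (x - g.r, y - g.s)) := rfl

/-- The action on functions of degree `1`:
`α_{(r,s,t)}(ξ)(x, y) = e (-(t + c s (x - r - μ))) ξ (x - r, y - s)`. -/
noncomputable def heisOnModFun (g : Heis c) (ξ : modQHM c μ ν) : modQHM c μ ν :=
  ⟨⟨fun z => e (-(g.t + c * g.s * (z.1 - g.r - μ))) * ξ.1 (z.1 - g.r, z.2 - g.s),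
      (continuous_e.comp (by fun_prop)).mul (ξ.1.continuous.comp (by fun_prop))⟩, fun x y => by
    have h1 := (ξ.2 (x - g.r) (y - g.s)).1
    have h2 := (ξ.2 (x - g.r) (y - g.s)).2
    simp only [ContinuousMap.coe_mk]
    rw [add_sub_right_comm, h1, add_sub_right_comm y, h2, ← mul_assoc, ← mul_assoc, ← e_add,
      ← e_add]
    refine ⟨?_, rfl⟩
    congr 2
    ring⟩

theorem heisOnModFun_apply (g : Heis c) (ξ : modQHM c μ ν) (x y : ℝ) :
    (heisOnModFun g ξ).1 (x, y) =
      e (-(g.t + c * g.s * (x - g.r - μ))) * ξ.1 (x - g.r, y - g.s) := rfl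

/-- The endomorphism of the Hilbert bimodule `X^c_{μ,ν}` given by an element of the Heisenberg
group. -/
noncomputable def heisEnd (μ ν : ℝ) (g : Heis c) :
    HilbertBimoduleEnd C(Torus, ℂ) (modQHM c μ ν) where
  onA := heisOnTorus g
  onE :=
    { toFun := heisOnModFun g
      map_add' := fun ξ η => mod_ext fun x y => by simp [heisOnModFun_apply, mul_add]
      map_smul' := fun k ξ => mod_ext fun x y => by simp [heisOnModFun_apply, mul_left_comm] }
  map_lsmul := fun a ξ => by
    change heisOnModFun g (lsmulFun a ξ) = lsmulFun (heisOnTorus g a) (heisOnModFun g ξ)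
    refine mod_ext fun x y => ?_
    simp only [heisOnModFun_apply, lsmulFun_apply, heisOnTorus_proj]
    ring
  map_rsmul := fun ξ a => by
    change heisOnModFun g (lsmulFun (sigma μ ν a) ξ) =
      lsmulFun (sigma μ ν (heisOnTorus g a)) (heisOnModFun g ξ)
    refine mod_ext fun x y => ?_
    simp only [heisOnModFun_apply, lsmulFun_apply, heisOnTorus_proj, sigma_proj]
    rw [sub_right_comm x, sub_right_comm y]
    ring_nf
  map_innerR := fun ξ η => by
    change heisOnTorus g (innerRFun ξ η) = innerRFun (heisOnModFun g ξ) (heisOnModFun g η)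
    refine torus_ext fun x y => ?_
    simp only [heisOnModFun_apply, heisOnTorus_proj, innerRFun_proj, star_mul]
    rw [add_sub_right_comm x, add_sub_right_comm y]
    linear_combination (-star (ξ.1 (x - g.r + 2 * μ, y - g.s + 2 * ν)) *
      η.1 (x - g.r + 2 * μ, y - g.s + 2 * ν)) *
        e_mul_star (-(g.t + c * g.s * (x - g.r + 2 * μ - μ)))
  map_innerL := fun ξ η => by
    change heisOnTorus g (innerLFun ξ η) = innerLFun (heisOnModFun g ξ) (heisOnModFun g η)
    refine torus_ext fun x y => ?_
    simp only [heisOnModFun_apply, heisOnTorus_proj, innerLFun_proj, star_mul]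
    linear_combination (-ξ.1 (x - g.r, y - g.s) * star (η.1 (x - g.r, y - g.s))) *
      e_mul_star (-(g.t + c * g.s * (x - g.r - μ)))

/-- The action `α` of the Heisenberg group on `D^c_{μ,ν}` by automorphisms, given in the degrees
`0` and `1`, which generate `D^c_{μ,ν}`, by `heisOnTorus` and `heisOnModFun`. -/
noncomputable def action (c : ℤ) (μ ν : ℝ) : Heis c →* (Alg c μ ν →⋆ₙₐ[ℂ] Alg c μ ν) where
  toFun := fun g => GenCrossedProduct.map (heisEnd μ ν g)
  map_one' := by
    refine GenCrossedProduct.hom_ext (fun a => ?_) (fun ξ => ?_)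
    · rw [GenCrossedProduct.map_π]
      refine congrArg _ (torus_ext fun x y => ?_)
      change heisOnTorus 1 a _ = _
      rw [heisOnTorus_proj, Heis.one_def, sub_zero, sub_zero]
    · rw [GenCrossedProduct.map_τ]
      refine congrArg _ (mod_ext fun x y => ?_)
      change (heisOnModFun 1 ξ).1 _ = _
      simp [heisOnModFun_apply, Heis.one_def, e_zero]
  map_mul' := fun g h => by
    refine GenCrossedProduct.hom_ext (fun a => ?_) (fun ξ => ?_)
    · change GenCrossedProduct.map _ _ = GenCrossedProduct.map _ (GenCrossedProduct.map _ _)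
      simp only [GenCrossedProduct.map_π]
      refine congrArg _ (torus_ext fun x y => ?_)
      change heisOnTorus (g * h) a _ = heisOnTorus g (heisOnTorus h a) _
      simp only [heisOnTorus_proj, Heis.mul_def, sub_sub]
    · change GenCrossedProduct.map _ _ = GenCrossedProduct.map _ (GenCrossedProduct.map _ _)
      simp only [GenCrossedProduct.map_τ]
      refine congrArg _ (mod_ext fun x y => ?_)
      change (heisOnModFun (g * h) ξ).1 _ = (heisOnModFun g (heisOnModFun h ξ)).1 _
      simp only [heisOnModFun_apply, Heis.mul_def, ← mul_assoc, ← e_add, sub_sub]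
      congr 2
      ring

/-! ### The representation `(π, T)` -/

/-- `π(a)(x, y) = a (-y, -x)`. -/
noncomputable def flipTorus (a : C(Torus, ℂ)) : C(Torus, ℂ) :=
  a.comp ⟨fun p => (-p.2, -p.1), by fun_prop⟩

/-- The functions of degree `-1`, i.e. the continuous functions `G` on `ℝ × ℝ/ℤ` with
`G (x + 1, y) = e (c (y + ν)) G (x, y)`. -/
def degNegOne (c : ℤ) (_μ ν : ℝ) : Set C(ℝ × ℝ, ℂ) :=
  {G | ∀ x y : ℝ, G (x + 1, y) = e (c * (y + ν)) * G (x, y) ∧ G (x, y + 1) = G (x, y)}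

/-- The involution on functions of degree `-1`: `G⋆(x, y) = conj (G (x - 2μ, y - 2ν))`. -/
noncomputable def starNegOne (G : degNegOne c μ ν) : modQHM c μ ν :=
  ⟨star (G.1.comp (planeShift (-(2 * μ)) (-(2 * ν)))), fun x y => by
    have h1 := (G.2 (x + -(2 * μ)) (y + -(2 * ν))).1
    have h2 := (G.2 (x + -(2 * μ)) (y + -(2 * ν))).2
    simp only [ContinuousMap.star_apply, ContinuousMap.comp_apply, planeShift,
      ContinuousMap.coe_mk]
    rw [add_right_comm x, h1, add_right_comm y 1, h2, star_mul, star_e, mul_comm]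
    refine ⟨?_, rfl⟩
    congr 3
    ring⟩

/-- The canonical map from the functions of degree `-1` to `D^c_{μ,ν}`: the adjoint of the
element of degree `1` given by `G⋆`. -/
noncomputable def ofNegOne (G : degNegOne c μ ν) : Alg c μ ν := star (ofMod (starNegOne G))

/-- `T(ξ)(x, y) = e (c (y + μ) (x + ν)) ξ (-y, -x)`, which is a function of degree `-1` for the
parameters `(ν, μ)`. -/
noncomputable def flipMod (ξ : modQHM c μ ν) : degNegOne c ν μ :=
  ⟨⟨fun z => e (c * (z.2 + μ) * (z.1 + ν)) * ξ.1 (-z.2, -z.1),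
      (continuous_e.comp (by fun_prop)).mul (ξ.1.continuous.comp (by fun_prop))⟩, fun x y => by
    have h1 := (ξ.2 (-y) (-x - 1)).2
    have h2 := (ξ.2 (-y - 1) (-x)).1
    rw [sub_add_cancel] at h1 h2
    simp only [ContinuousMap.coe_mk, neg_add]
    rw [← sub_eq_add_neg (-x), ← sub_eq_add_neg (-y), ← h1]
    constructor
    · rw [← mul_assoc, ← e_add]
      congr 2
      ring
    · rw [h2, ← mul_assoc, ← e_add]
      congr 2
      ring⟩

end QHM

/-! ### Conjugate-linear morphisms of Hilbert bimodules which exchange left and right -/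

section AntiMorphism

/-! The map `T` takes values in degree -1, so its adjoint `ξ ↦ T(ξ)⋆` is a conjugate-linear map from
`X^c_{μ,ν}` to `X^c_{ν,μ}`. The defining relations of a covariant representation are symmetric under
replacing `τ` by its adjoint, provided that the left and right structures trade places. Hence a
conjugate-linear φ which exchanges these structures pulls a covariant representation `(π, τ)` back
to `(π ∘ φ, star ∘ τ ∘ φ)`, and induces a `*`-homomorphism of generalised crossed products. If φ has
an inverse of the same kind, this is an isomorphism. `*`-homomorphisms are compared on generators by
`hom_ext`, which gives uniqueness, inverses and equivariance.

What remains is explicit. With `u = x - ν` and `v = y - μ`, the map sends `ξ` to `e(-c u v) conj ξ(μ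
- v, ν - u)`: a reflection exchanging the centres `(μ, ν)` and `(ν, μ)`, times the phase that moves
the quasi-periodicity from one variable to the other. The phase cancels in the inner products, the
reflection turns the untwisted left action into the right action twisted by σ and vice versa, and
the same formula with `μ`, `ν` exchanged is the inverse. Completing the product in the phase of the
Heisenberg action produces the term `c s r`. -/

/-- A conjugate-linear map `E → F` of Hilbert bimodules over a `*`-homomorphism `A → B`, which
exchanges the left and the right structures. -/
structure HilbertBimoduleAntiHom (A : Type u) [NonUnitalCStarAlgebra A]
    (E : Type v) [AddCommGroup E] [Module ℂ E] [HilbertBimodule A E]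
    (B : Type u) [NonUnitalCStarAlgebra B]
    (F : Type v) [AddCommGroup F] [Module ℂ F] [HilbertBimodule B F] where
  onA : A →⋆ₙₐ[ℂ] B
  onE : E →ₗ⋆[ℂ] F
  map_lsmul : ∀ a ξ,
    onE (HilbertBimodule.lsmul a ξ) = HilbertBimodule.rsmul (onE ξ) (star (onA a))
  map_rsmul : ∀ ξ a,
    onE (HilbertBimodule.rsmul ξ a) = HilbertBimodule.lsmul (star (onA a)) (onE ξ)
  map_innerR : ∀ ξ ζ,
    onA (HilbertBimodule.innerR ξ ζ) = HilbertBimodule.innerL (onE ξ) (onE ζ)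
  map_innerL : ∀ ξ ζ,
    onA (HilbertBimodule.innerL ξ ζ) = HilbertBimodule.innerR (onE ξ) (onE ζ)

variable {A : Type u} [NonUnitalCStarAlgebra A]
  {E : Type v} [AddCommGroup E] [Module ℂ E] [HilbertBimodule A E]
  {B : Type u} [NonUnitalCStarAlgebra B]
  {F : Type v} [AddCommGroup F] [Module ℂ F] [HilbertBimodule B F]

/-- The pull-back `(π ∘ φ, star ∘ τ ∘ φ)` of a covariant representation `(π, τ)`. -/
def CovariantRep.antiPull {D : Type w} [NonUnitalCStarAlgebra D] (ρ : CovariantRep B F D)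
    (φ : HilbertBimoduleAntiHom A E B F) : CovariantRep A E D where
  π := ρ.π.comp φ.onA
  τ :=
    -- The adjoint and `φ.onE` are both conjugate-linear, so the composite is linear.
    { toFun := fun ξ => star (ρ.τ (φ.onE ξ))
      map_add' := fun ξ ζ => by simp
      map_smul' := fun k ξ => by simp [star_smul] }
  -- Adjoints turn each relation for `ρ` into the opposite one: `τ⋆τ` comes from `ττ⋆`, and left
  -- multiplication by `π` from right multiplication. Reversing a product also puts a star on the
  -- coefficient, which is the `star (onA a)` in `map_lsmul` and `map_rsmul`.
  star_τ_mul_τ := fun ξ ζ => by simp [ρ.τ_mul_star_τ, φ.map_innerR]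
  τ_mul_π := fun ξ a => by
    simp [φ.map_rsmul, ← ρ.π_mul_τ, map_star]
  π_mul_τ := fun a ξ => by
    simp [φ.map_lsmul, ← ρ.τ_mul_π, map_star]
  τ_mul_star_τ := fun ξ ζ => by simp [ρ.star_τ_mul_τ, φ.map_innerL]

/-- The homomorphism of the products of all covariant representations whose
`(π, τ)`-component is the component at the pull-back of `(π, τ)`. -/
noncomputable def productAntiMap (φ : HilbertBimoduleAntiHom A E B F) :
    CovariantProduct A E →⋆ₙₐ[ℂ] CovariantProduct B F where
  -- `existsUnique_lift` does not apply to a generalised crossed product as target, which lives one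
  -- universe above the carriers. Reindexing the components needs no such lift; it only uses that
  -- both products range over carriers in the same universe.
  toFun := fun x => ⟨fun i => x ⟨i.carrier, i.rep.antiPull φ⟩, memℓp_infty ⟨‖x‖, by
    rintro _ ⟨i, rfl⟩
    exact lp.norm_apply_le_norm ENNReal.top_ne_zero x ⟨i.carrier, i.rep.antiPull φ⟩⟩⟩
  map_smul' := fun _ _ => rfl
  map_zero' := rfl
  map_add' := fun _ _ => rfl
  map_mul' := fun _ _ => rfl
  map_star' := fun _ => rfl

theorem productAntiMap_mem (φ : HilbertBimoduleAntiHom A E B F) (x : CovariantProduct A E)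
    (hx : x ∈ genCrossedProduct A E) : productAntiMap φ x ∈ genCrossedProduct B F := by
  have hc : Continuous (productAntiMap φ) :=
    AddMonoidHomClass.continuous_of_bound (productAntiMap φ) 1 fun x => by
      simpa using NonUnitalStarAlgHom.norm_apply_le (productAntiMap φ) x
  have h : genCrossedProduct A E ≤ (genCrossedProduct B F).comap (productAntiMap φ) := by
    refine NonUnitalStarSubalgebra.topologicalClosure_minimal _ ?_
      ((genCrossedProduct_isClosed B F).preimage hc)
    refine NonUnitalStarAlgebra.adjoin_le ?_
    rintro _ (⟨a, rfl⟩ | ⟨ξ, rfl⟩)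
    · exact mem_genCrossedProduct (Or.inl ⟨φ.onA a, rfl⟩)
    -- The image of `ξ` is not a generator but the adjoint of one, since the degree changes sign.
    · exact star_mem (mem_genCrossedProduct (Or.inr ⟨φ.onE ξ, rfl⟩))
  exact h hx

/-- The homomorphism of generalised crossed products which maps `a` to `φ a` and `ξ` to
`star (φ ξ)`. -/
noncomputable def GenCrossedProduct.antiMap (φ : HilbertBimoduleAntiHom A E B F) :
    GenCrossedProduct A E →⋆ₙₐ[ℂ] GenCrossedProduct B F where
  toFun := fun x => ⟨productAntiMap φ x.1, productAntiMap_mem φ x.1 x.2⟩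
  map_smul' := fun _ _ => rfl
  map_zero' := rfl
  map_add' := fun _ _ => rfl
  map_mul' := fun _ _ => rfl
  map_star' := fun _ => rfl

/-- Definitional, as is the formula for `τ`: in the component of `(π, τ)` both sides are the
pulled-back representation evaluated at the generator. -/
theorem GenCrossedProduct.antiMap_π (φ : HilbertBimoduleAntiHom A E B F) (a : A) :
    antiMap φ (univRep.π a) = univRep.π (φ.onA a) := rfl

theorem GenCrossedProduct.antiMap_τ (φ : HilbertBimoduleAntiHom A E B F) (ξ : E) :
    antiMap φ (univRep.τ ξ) = star (univRep.τ (φ.onE ξ)) := rfl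

/-- Two passages to the adjoint cancel, so the composite fixes the generators. -/
theorem GenCrossedProduct.antiMap_antiMap (φ : HilbertBimoduleAntiHom A E B F)
    (ψ : HilbertBimoduleAntiHom B F A E) (hA : ∀ a, ψ.onA (φ.onA a) = a)
    (hE : ∀ ξ, ψ.onE (φ.onE ξ) = ξ) (x : GenCrossedProduct A E) :
    antiMap ψ (antiMap φ x) = x := by
  have h : (antiMap ψ).comp (antiMap φ) =
      NonUnitalStarAlgHom.id ℂ (GenCrossedProduct A E) := by
    refine hom_ext (fun a => ?_) (fun ξ => ?_)
    · rw [NonUnitalStarAlgHom.comp_apply, antiMap_π, antiMap_π, hA]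
      rfl
    · rw [NonUnitalStarAlgHom.comp_apply, antiMap_τ, map_star, antiMap_τ, star_star, hE]
      rfl
  exact DFunLike.congr_fun h x

/-- Mutually inverse anti-morphisms of Hilbert bimodules induce an isomorphism of the generalised
crossed products. -/
noncomputable def GenCrossedProduct.antiEquiv (φ : HilbertBimoduleAntiHom A E B F)
    (ψ : HilbertBimoduleAntiHom B F A E) (hA : ∀ a, ψ.onA (φ.onA a) = a)
    (hE : ∀ ξ, ψ.onE (φ.onE ξ) = ξ) (hB : ∀ b, φ.onA (ψ.onA b) = b)
    (hF : ∀ η, φ.onE (ψ.onE η) = η) : GenCrossedProduct A E ≃⋆ₐ[ℂ] GenCrossedProduct B F where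
  toFun := antiMap φ
  invFun := antiMap ψ
  left_inv := antiMap_antiMap φ ψ hA hE
  right_inv := antiMap_antiMap ψ φ hB hF
  map_mul' := map_mul (antiMap φ)
  map_add' := map_add (antiMap φ)
  map_star' := map_star (antiMap φ)
  map_smul' := map_smul (antiMap φ)

/-- Only generators matter, and on `E` the adjoint commutes with `map β`; thus equivariance is
reduced to the bimodules. -/
theorem GenCrossedProduct.antiMap_map (φ : HilbertBimoduleAntiHom A E B F)
    (α : HilbertBimoduleEnd A E) (β : HilbertBimoduleEnd B F)
    (hA : ∀ a, φ.onA (α.onA a) = β.onA (φ.onA a))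
    (hE : ∀ ξ, φ.onE (α.onE ξ) = β.onE (φ.onE ξ)) (x : GenCrossedProduct A E) :
    antiMap φ (map α x) = map β (antiMap φ x) := by
  have h : (antiMap φ).comp (map α) = (map β).comp (antiMap φ) := by
    refine hom_ext (fun a => ?_) (fun ξ => ?_)
    · simp only [NonUnitalStarAlgHom.comp_apply, map_π, antiMap_π, hA]
    · simp only [NonUnitalStarAlgHom.comp_apply, map_τ, antiMap_τ, map_star, hE]
  exact DFunLike.congr_fun h x

end AntiMorphism

/-! ### The flip of the quantum Heisenberg manifolds -/

namespace QHM

variable {c : ℤ} {μ ν : ℝ}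

theorem flipTorus_proj (a : C(Torus, ℂ)) (x y : ℝ) :
    flipTorus a (torusProj (x, y)) = a (torusProj (-y, -x)) := rfl

/-- `a ↦ flipTorus a` as a `*`-homomorphism. -/
noncomputable def flipTorusHom : C(Torus, ℂ) →⋆ₙₐ[ℂ] C(Torus, ℂ) where
  toFun := flipTorus
  map_smul' := fun _ _ => rfl
  map_zero' := rfl
  map_add' := fun _ _ => rfl
  map_mul' := fun _ _ => rfl
  map_star' := fun _ => rfl

theorem flipTorus_flipTorus (a : C(Torus, ℂ)) : flipTorus (flipTorus a) = a :=
  torus_ext fun x y => by simp only [flipTorus_proj, neg_neg]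

/-! ### The anti-morphism between `X^c_{μ,ν}` and `X^c_{ν,μ}` -/

/-- The involution for the parameters `(ν, μ)` shifts by `(-2ν, -2μ)`, which turns `y + μ` and `x +
ν` in the phase of `flipMod` into `y - μ` and `x - ν`. All later computations use this form. -/
theorem starNegOne_flipMod_apply (ξ : modQHM c μ ν) (x y : ℝ) :
    (starNegOne (flipMod ξ)).1 (x, y) =
      e (-(c * (y - μ) * (x - ν))) * star (ξ.1 (2 * μ - y, 2 * ν - x)) := by
  change star (e (c * (y + -(2 * μ) + μ) * (x + -(2 * ν) + ν)) *
    ξ.1 (-(y + -(2 * μ)), -(x + -(2 * ν)))) = _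
  rw [star_mul, star_e, mul_comm]
  ring_nf

/-- The reflection with `μ`, `ν` exchanged undoes the first one. It changes the sign of both factors
in the phase, hence preserves their product, and the conjugated phase cancels the other. -/
theorem starNegOne_flipMod_starNegOne_flipMod (ξ : modQHM c μ ν) :
    starNegOne (flipMod (starNegOne (flipMod ξ))) = ξ := mod_ext fun x y => by
  rw [starNegOne_flipMod_apply, starNegOne_flipMod_apply, star_mul, star_star, star_e,
    sub_sub_cancel, sub_sub_cancel, mul_left_comm, ← e_add]
  rw [show -(c * (y - ν) * (x - μ)) + - -(c * (2 * μ - x - μ) * (2 * ν - y - ν)) = (0 : ℝ) by ring,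
    e_zero, mul_one]

/-- The anti-morphism `X^c_{μ,ν} → X^c_{ν,μ}` given by `a ↦ flipTorus a` and
`ξ ↦ (flipMod ξ)⋆`. -/
noncomputable def flipAntiHom (c : ℤ) (μ ν : ℝ) :
    HilbertBimoduleAntiHom C(Torus, ℂ) (modQHM c μ ν) C(Torus, ℂ) (modQHM c ν μ) where
  onA := flipTorusHom
  onE :=
    { toFun := fun ξ => starNegOne (flipMod ξ)
      map_add' := fun ξ η => mod_ext fun x y => by
        simp [starNegOne_flipMod_apply, mul_add]
      map_smul' := fun k ξ => mod_ext fun x y => by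
        simp [starNegOne_flipMod_apply, mul_left_comm] }
  map_lsmul := fun a ξ => by
    change starNegOne (flipMod (lsmulFun a ξ)) =
      lsmulFun (sigma ν μ (star (flipTorus a))) (starNegOne (flipMod ξ))
    -- The value of `a` at `(2μ - y, 2ν - x)` is that of `flipTorus a` at `(x - 2ν, y - 2μ)`: the
    -- twist σ for `(ν, μ)`.
    refine mod_ext fun x y => ?_
    simp only [starNegOne_flipMod_apply, lsmulFun_apply, sigma_proj, ContinuousMap.star_apply,
      flipTorus_proj, star_mul, neg_sub]
    ring
  map_rsmul := fun ξ a => by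
    change starNegOne (flipMod (lsmulFun (sigma μ ν a) ξ)) =
      lsmulFun (star (flipTorus a)) (starNegOne (flipMod ξ))
    -- Here the shift by `(2μ, 2ν)` in the reflection cancels σ and leaves `a` at `(-y, -x)`.
    refine mod_ext fun x y => ?_
    simp only [starNegOne_flipMod_apply, lsmulFun_apply, sigma_proj, ContinuousMap.star_apply,
      flipTorus_proj, star_mul, sub_sub_cancel_left]
    ring
  map_innerR := fun ξ η => by
    change flipTorus (innerRFun ξ η) =
      innerLFun (starNegOne (flipMod ξ)) (starNegOne (flipMod η))
    refine torus_ext fun x y => ?_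
    simp only [starNegOne_flipMod_apply, flipTorus_proj, innerRFun_proj, innerLFun_proj, star_mul,
      star_star, neg_add_eq_sub]
    -- The two sides differ by a phase times its conjugate, which is 1.
    linear_combination (-star (ξ.1 (2 * μ - y, 2 * ν - x)) * η.1 (2 * μ - y, 2 * ν - x)) *
      e_mul_star (-(c * (y - μ) * (x - ν)))
  map_innerL := fun ξ η => by
    change flipTorus (innerLFun ξ η) =
      innerRFun (starNegOne (flipMod ξ)) (starNegOne (flipMod η))
    refine torus_ext fun x y => ?_
    simp only [starNegOne_flipMod_apply, flipTorus_proj, innerRFun_proj, innerLFun_proj, star_mul,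
      star_star, sub_add_cancel_right]
    -- The phase is now taken at `(x + 2ν, y + 2μ)`, where the right inner product for `(ν, μ)` is
    -- evaluated.
    linear_combination (-ξ.1 (-y, -x) * star (η.1 (-y, -x))) *
      e_mul_star (-(c * (y + 2 * μ - μ) * (x + 2 * ν - ν)))

/-! ### Equivariance under the Heisenberg group -/

/-- The third coordinate `t'` is arbitrary because the centre acts trivially in degree 0. -/
theorem flipTorus_heisOnTorus (r s t t' : ℝ) (a : C(Torus, ℂ)) :
    flipTorus (heisOnTorus (⟨r, s, t⟩ : Heis c) a) =
      heisOnTorus (⟨-s, -r, t'⟩ : Heis c) (flipTorus a) :=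
  torus_ext fun x y => by
    simp only [flipTorus_proj, heisOnTorus_proj, sub_neg_eq_add, neg_add, ← sub_eq_add_neg]

/-- With `u = x - ν`, `v = y - μ`, the left phase is `-c u v + t - c s (v + r)`. On the right, with
third coordinate `t'`, it is `-t' + c r (u + s) - c (v + r)(u + s) = -t' - c v (u + s)`. Equality
forces `t' = -t + c s r`. -/
theorem starNegOne_flipMod_heisOnModFun (r s t : ℝ) (ξ : modQHM c μ ν) :
    starNegOne (flipMod (heisOnModFun ⟨r, s, t⟩ ξ)) =
      heisOnModFun ⟨-s, -r, -t + c * s * r⟩ (starNegOne (flipMod ξ)) :=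
  mod_ext fun x y => by
    simp only [starNegOne_flipMod_apply, heisOnModFun_apply, star_mul, star_e, sub_neg_eq_add,
      ← sub_sub]
    rw [mul_left_comm, mul_comm (star _), ← mul_assoc, ← e_add, ← e_add]
    congr 2
    ring

end QHM

theorem mainTheorem8 (c : ℤ) (hc : 0 < c) (μ ν : ℝ) :
    ∃ ρ : CovariantRep C(QHM.Torus, ℂ) (QHM.modQHM c μ ν) (QHM.Alg c ν μ),
      (∀ a, ρ.π a = QHM.ofTorus c ν μ (QHM.flipTorus a)) ∧
      (∀ ξ, ρ.τ ξ = QHM.ofNegOne (QHM.flipMod ξ)) ∧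
      ∃ Φ : QHM.Alg c μ ν ≃⋆ₐ[ℂ] QHM.Alg c ν μ,
        (∀ a, Φ (QHM.ofTorus c μ ν a) = ρ.π a) ∧
        (∀ ξ : QHM.modQHM c μ ν, Φ (QHM.ofMod ξ) = ρ.τ ξ) ∧
        (∀ Ψ : QHM.Alg c μ ν →⋆ₙₐ[ℂ] QHM.Alg c ν μ,
          (∀ a, Ψ (QHM.ofTorus c μ ν a) = ρ.π a) →
          (∀ ξ : QHM.modQHM c μ ν, Ψ (QHM.ofMod ξ) = ρ.τ ξ) → ∀ F, Ψ F = Φ F) ∧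
        ∀ (r s t : ℝ) (F : QHM.Alg c μ ν),
          Φ (QHM.action c μ ν ⟨r, s, t⟩ F) =
            QHM.action c ν μ ⟨-s, -r, -t + c * s * r⟩ (Φ F) := by
  -- The pull-back of the universal representation is `(π, T)` by definition, because `ofNegOne` is
  -- the adjoint of `ofMod` after `starNegOne`. The inverse of Φ comes from the same anti-morphism
  -- with `μ` and `ν` exchanged.
  refine ⟨univRep.antiPull (QHM.flipAntiHom c μ ν), fun _ => rfl, fun _ => rfl,
    GenCrossedProduct.antiEquiv (QHM.flipAntiHom c μ ν) (QHM.flipAntiHom c ν μ)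
      QHM.flipTorus_flipTorus QHM.starNegOne_flipMod_starNegOne_flipMod
      QHM.flipTorus_flipTorus QHM.starNegOne_flipMod_starNegOne_flipMod,
    fun _ => rfl, fun _ => rfl, fun Ψ hA hE F => ?_, fun r s t F => ?_⟩
  · exact DFunLike.congr_fun
      (GenCrossedProduct.hom_ext (g := GenCrossedProduct.antiMap (QHM.flipAntiHom c μ ν)) hA hE) F
  · exact GenCrossedProduct.antiMap_map (QHM.flipAntiHom c μ ν) (QHM.heisEnd μ ν ⟨r, s, t⟩)
      (QHM.heisEnd ν μ ⟨-s, -r, -t + c * s * r⟩) (QHM.flipTorus_heisOnTorus r s t _)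
      (QHM.starNegOne_flipMod_heisOnModFun r s t) F
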